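/- **Theorem 3.4 (Finite activity identification).** *Setting.* Let $R:\mathbb{R}^n\to\mathbb{R}\cup\{+\infty\}$ be proper, convex and lower semicontinuous, let $\beta>0$, and let $F:\mathbb{R}^n\to\mathbb{R}$ be $C^1$ with $\frac1\beta$-Lipschitz gradient. Let $\bar a,\bar b\le 1$ and $\underline\epsilon,\bar\epsilon>0$ with $\underline\epsilon\le 2\beta-\bar\epsilon$, let $a_k\in[0,\bar a]$, $b_k\in[0,\bar b]$, $\gamma_k\in[\underline\epsilon,2\beta-\bar\epsilon]$ for $k\in\mathbb{N}$, and let $(x_k)_{k\in\mathbb{N}}$ be generated, with $x_{-1}=x_0\in\mathbb{R}^n$, by the forward–backward (FB) type iteration $$y_{a,k}=x_k+a_k(x_k-x_{k-1}),\quad y_{b,k}=x_k+b_k(x_k-x_{k-1}),\quad x_{k+1}=\operatorname{prox}_{\gamma_kR}\big(y_{a,k}-\gamma_k\nabla F(y_{b,k})\big),$$ where $\operatorname{prox}_{\gamma R}(z)$ is the minimizer of $u\mapsto\frac12\|u-z\|^2+\gamma R(u)$. *Definitions.* $\partial R$ is the convex subdifferential, $\operatorname{ri}$ is the relative interior, $P_T$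 is the orthogonal projector onto $T$, and $T_x=\operatorname{par}(\partial R(x))^\perp$, where $\operatorname{par}(\partial R(x))$ is the linear span of $\partial R(x)-\partial R(x)$. The function $R$ is *partly smooth at $x$ relative to a set $\mathcal M\ni x$* if $\partial R(x)\neq\emptyset$; $\mathcal M$ is a $C^2$-smooth embedded submanifold of $\mathbb{R}^n$ around $x$; there is a real function, $C^2$ around $x$, that agrees with $R$ on $\mathcal M$ near $x$; the tangent space $\mathcal T_{\mathcal M}(x)$ equals $T_x$; and the set-valued map $\partial R$ is continuous (outer and inner semicontinuous) at $x$ relative to $\mathcal M$. The function $R$ is *locally polyhedral around $x$* if it agrees near $x$ with a function whose epigraph is a finite intersection of closed half-spaces. For $x'\in\mathcal M$ near $x$, the Riemannian gradient is $\nabla_{\mathcal M}R(x')=P_{\mathcal T_{\mathcal M}(x')}\nabla\widetilde R(x')$, for any function $\widetilde R$ that is $C^2$ around $x'$ and agrees with $R$ on $\mathcal M$ near $x'$, and the Riemannian Hessian is $\nabla^2_{\mathcal M}R(x')h=P_{\mathcal T_{\mathcal M}(x')}\,d(\nabla_{\mathcal M}R)(x')[h]$ for $h\in\mathcal T_{\mathcal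 M}(x')$. *Statement.* Suppose that $(x_k)$ converges to a global minimizer $x^\star$ of $F+R$, that $R$ is partly smooth at $x^\star$ relative to $\mathcal M$, that $F$ is $C^2$ in a neighbourhood of $x^\star$, and that the non-degeneracy condition $$-\nabla F(x^\star)\in\operatorname{ri}\big(\partial R(x^\star)\big)$$ holds. Then there is an integer $K>0$ such that $x_k\in\mathcal M$ for all $k\ge K$. Moreover, with the same $K$: (i) if $\mathcal M$ is an affine subspace, then $\mathcal M=x^\star+T_{x^\star}$, and $y_{a,k},y_{b,k}\in\mathcal M$ for all $k>K$; (ii) if $R$ is locally polyhedral around $x^\star$, then $\mathcal M$ coincides with $x^\star+T_{x^\star}$ in a neighbourhood of $x^\star$; $y_{a,k},y_{b,k}\in\mathcal M\cap(x^\star+T_{x^\star})$ for all $k>K$; the Riemannian gradients $\nabla_{\mathcal M}R(x^\star)$ and $\nabla_{\mathcal M}R(x_k)$, $k\ge K$, and the Riemannian Hessians $\nabla^2_{\mathcal M}R(x_k)$, $k\ge K$, exist; and $\nabla_{\mathcal M}R(x_k)=\nabla_{\mathcal M}R(x^\star)$ and $\nabla^2_{\mathcal M}R(x_k)=0$ for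 all $k\ge K$. -/

import Mathlib

open Filter Topology

/-- The Euclidean space `ℝⁿ`. -/
abbrev Rn (n : ℕ) : Type := EuclideanSpace ℝ (Fin n)

/-- The class `Γ₀(ℝⁿ)`: proper convex lower semicontinuous functions with values in `ℝ ∪ {+∞}`.
Convexity is convexity of the epigraph. -/
structure IsGammaZero {n : ℕ} (R : Rn n → EReal) : Prop where
  ne_bot : ∀ u, R u ≠ ⊥
  exists_ne_top : ∃ u, R u ≠ ⊤
  convex_epigraph : Convex ℝ {p : Rn n × ℝ | R p.1 ≤ (p.2 : EReal)}
  lsc : LowerSemicontinuous R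

/-- The convex subdifferential `∂R(x)`. -/
def subdiff {n : ℕ} (R : Rn n → EReal) (x : Rn n) : Set (Rn n) :=
  {g | ∀ y, R x + ((inner ℝ g (y - x) : ℝ) : EReal) ≤ R y}

/-- `T_x = par(∂R(x))^⊥`, the orthogonal complement of the subspace parallel to `∂R(x)`. -/
noncomputable def modelSubspace {n : ℕ} (R : Rn n → EReal) (x : Rn n) : Submodule ℝ (Rn n) :=
  (vectorSpan ℝ (subdiff R x))ᗮ

/-- `M` is a `C²`-smooth embedded submanifold of `ℝⁿ` around its point `x`: some `C²`
diffeomorphism defined on an open neighbourhood of `x` straightens `M` to a linear subspace. -/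
def IsC2ManifoldAround {n : ℕ} (M : Set (Rn n)) (x : Rn n) : Prop :=
  x ∈ M ∧ ∃ (φ : OpenPartialHomeomorph (Rn n) (Rn n)) (V : Submodule ℝ (Rn n)),
    x ∈ φ.source ∧ ContDiffOn ℝ 2 φ φ.source ∧ ContDiffOn ℝ 2 φ.symm φ.target ∧
      ∀ y ∈ φ.source, (y ∈ M ↔ φ y ∈ V)

/-- The tangent space `𝒯_M(x)`: the velocities at `x` of curves in `M`. (When `M` is a manifold
around `x`, these velocities already form a subspace; the span only makes it one by type.) -/
def tangentSpaceAt {n : ℕ} (M : Set (Rn n)) (x : Rn n) : Submodule ℝ (Rn n) :=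
  Submodule.span ℝ
    {v | ∃ c : ℝ → Rn n, c 0 = x ∧ (∀ᶠ t in 𝓝 (0 : ℝ), c t ∈ M) ∧ HasDerivAt c v 0}

/-- `G'` is a `C²` representative (smooth extension) near `x` of the restriction of `G` to `M`. -/
def IsC2Representative {n : ℕ} (M : Set (Rn n)) (G : Rn n → EReal) (x : Rn n)
    (G' : Rn n → ℝ) : Prop :=
  ContDiffAt ℝ 2 G' x ∧ ∀ᶠ y in 𝓝[M] x, G y = (G' y : EReal)

/-- Continuity of a set-valued map `S` at `x` relative to `M` (in the Painlevé–Kuratowski sense):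
outer semicontinuity together with inner semicontinuity. -/
structure SetValuedContinuousAt {n : ℕ} (S : Rn n → Set (Rn n)) (M : Set (Rn n)) (x : Rn n) :
    Prop where
  outer : ∀ (u g : ℕ → Rn n) (g₀ : Rn n), (∀ k, u k ∈ M) → Tendsto u atTop (𝓝 x) →
    (∀ k, g k ∈ S (u k)) → Tendsto g atTop (𝓝 g₀) → g₀ ∈ S x
  inner : ∀ g₀ ∈ S x, ∀ U ∈ 𝓝 g₀, ∀ᶠ u in 𝓝[M] x, (S u ∩ U).Nonempty

/-- `R` is partly smooth at `x` relative to the set `M ∋ x` (for `R ∈ Γ₀(ℝⁿ)`). -/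
structure IsPartlySmoothAt {n : ℕ} (R : Rn n → EReal) (M : Set (Rn n)) (x : Rn n) : Prop where
  subdiff_nonempty : (subdiff R x).Nonempty
  manifold : IsC2ManifoldAround M x
  smooth : ∃ R' : Rn n → ℝ, IsC2Representative M R x R'
  sharp : tangentSpaceAt M x = modelSubspace R x
  continuous : SetValuedContinuousAt (subdiff R) M x

/-- `g` is the Riemannian gradient `∇_M G(x) = P_{𝒯_M(x)} ∇G'(x)`, with `G'` a `C²`
representative of `G` on `M` near `x` (the value does not depend on the representative). -/
def HasRiemannianGradAt {n : ℕ} (M : Set (Rn n)) (G : Rn n → EReal) (x g : Rn n) : Prop :=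
  x ∈ M ∧ ∃ G' : Rn n → ℝ, IsC2Representative M G x G' ∧
    g = (tangentSpaceAt M x).starProjection (gradient G' x)

/-- `H` is the Riemannian Hessian `∇²_M G(x) h = P_{𝒯_M(x)} d(∇_M G)(x)[h]`, `h ∈ 𝒯_M(x)`, where
the differential is that, along `M`, of the Riemannian gradient field `X = ∇_M G` near `x`. -/
def HasRiemannianHessAt {n : ℕ} (M : Set (Rn n)) (G : Rn n → EReal) (x : Rn n)
    (H : tangentSpaceAt M x →ₗ[ℝ] tangentSpaceAt M x) : Prop :=
  x ∈ M ∧ ∃ (X : Rn n → Rn n) (L : Rn n →L[ℝ] Rn n),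
    (∀ᶠ y in 𝓝[M] x, HasRiemannianGradAt M G y (X y)) ∧ HasFDerivWithinAt X L M x ∧
      ∀ h : tangentSpaceAt M x, (H h : Rn n) = (tangentSpaceAt M x).starProjection (L h)

/-- `P` is a polyhedral function: its epigraph is a finite intersection of closed half-spaces
`{(y, r) | ⟨q, y⟩ + α r ≤ β}`. -/
def IsPolyhedralFun {n : ℕ} (P : Rn n → EReal) : Prop :=
  ∃ s : Finset (Rn n × ℝ × ℝ), ∀ (y : Rn n) (r : ℝ),
    P y ≤ (r : EReal) ↔ ∀ q ∈ s, inner ℝ q.1 y + q.2.1 * r ≤ q.2.2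

/-- `R` is locally polyhedral around `x`: it agrees near `x` with a polyhedral function. -/
def IsLocallyPolyhedralAt {n : ℕ} (R : Rn n → EReal) (x : Rn n) : Prop :=
  ∃ P : Rn n → EReal, IsPolyhedralFun P ∧ ∀ᶠ y in 𝓝 x, R y = P y

/-- `p = prox_{γ R}(z)`: `p` minimizes `½‖u - z‖² + γ R(u)` over `u ∈ ℝⁿ`. -/
def IsProx {n : ℕ} (R : Rn n → EReal) (γ : ℝ) (z p : Rn n) : Prop :=
  IsMinOn (fun u => ((1 / 2 * ‖u - z‖ ^ 2 : ℝ) : EReal) + (γ : EReal) * R u) Set.univ p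

/-- The inertial point `x_k + a_k (x_k - x_{k-1})`. The truncated subtraction at `k = 0`
gives `x 0`, which is the convention `x_{-1} = x_0`. -/
noncomputable def inertialPoint {n : ℕ} (x : ℕ → Rn n) (a : ℕ → ℝ) (k : ℕ) : Rn n :=
  x k + a k • (x k - x (k - 1))

/-- The sequence `x` is produced by the general inertial Forward–Backward splitting for `F + R`
with parameters `ā, b̄ ≤ 1`, `ε₁, ε₂ > 0`, `ε₁ ≤ 2β - ε₂`, `a_k ∈ [0, ā]`, `b_k ∈ [0, b̄]` and
step sizes `γ_k ∈ [ε₁, 2β - ε₂]`. -/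
structure IsFBSequence {n : ℕ} (F : Rn n → ℝ) (R : Rn n → EReal) (β abar bbar ε₁ ε₂ : ℝ)
    (a b γ : ℕ → ℝ) (x : ℕ → Rn n) : Prop where
  abar_le : abar ≤ 1
  bbar_le : bbar ≤ 1
  eps₁_pos : 0 < ε₁
  eps₂_pos : 0 < ε₂
  eps_le : ε₁ ≤ 2 * β - ε₂
  a_mem : ∀ k, a k ∈ Set.Icc 0 abar
  b_mem : ∀ k, b k ∈ Set.Icc 0 bbar
  step_mem : ∀ k, γ k ∈ Set.Icc ε₁ (2 * β - ε₂)
  iter : ∀ k, IsProx R (γ k)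
    (inertialPoint x a k - γ k • gradient F (inertialPoint x b k)) (x (k + 1))

/-!
The proximal step produces subgradients of `R` at the iterates which converge to `-∇F(x⋆)`, a point
of `ri ∂R(x⋆)`. If infinitely many iterates were off `M`, the unit vectors pointing to them from
their nearest points on `M` would accumulate at a vector `e` normal to `M` at `x⋆`; by sharpness `e`
is parallel to `∂R(x⋆)`, so `-∇F(x⋆) + ε e` is again a subgradient, which inner semicontinuity of
`∂R` along `M` transports to the nearest points. Monotonicity of `∂R` then says `-ε ≥ 0`. This is
`IsPartlySmoothAt.eventually_mem`, applied in `IsFBSequence.eventually_mem`.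

An affine `M` equals `x⋆ + T` because its direction is its tangent space, and the inertial points
are affine combinations of two iterates.

If `R` is locally polyhedral, then `∂R(u) ⊆ ∂R(x⋆)` for `u ∈ M` near `x⋆`
(`IsLocallyPolyhedralAt.eventually_subdiff_subset`). Since `∂R(u)` contains relatively interior
points of `∂R(x⋆)`, the manifold lies in `x⋆ + T` and `R` is affine on it
(`IsPartlySmoothAt.eventually_affine_of_polyhedral`); by the inverse function theorem
`M` fills `x⋆ + T` near `x⋆` (`eventually_mem_of_subset_affine`). On a flat piece of manifold an
affine function has constant Riemannian gradient and zero Riemannian Hessian.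
-/

/-! ### Real-valued forms of convexity and of the subgradient inequality -/

/-- Convexity of the epigraph along a segment, with real upper bounds instead of `EReal` values. -/
theorem IsGammaZero.combo_le {n : ℕ} {R : Rn n → EReal} (hR : IsGammaZero R) {u v : Rn n}
    {r s t : ℝ} (hu : R u ≤ (r : EReal)) (hv : R v ≤ (s : EReal)) (ht0 : 0 ≤ t) (ht1 : t ≤ 1) :
    R (u + t • (v - u)) ≤ ((r + t * (s - r) : ℝ) : EReal) := by
  have h := hR.convex_epigraph (x := (u, r)) hu (y := (v, s)) hv (sub_nonneg.2 ht1) ht0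
    (by ring)
  have e : (1 - t) • (u, r) + t • (v, s) = (u + t • (v - u), r + t * (s - r)) := by
    ext1
    · simp only [Prod.fst_add, Prod.smul_fst]; module
    · simp only [Prod.snd_add, Prod.smul_snd, smul_eq_mul]; ring
  rw [e] at h
  exact h

theorem IsGammaZero.ne_top_of_mem_subdiff {n : ℕ} {R : Rn n → EReal} (hR : IsGammaZero R)
    {x g : Rn n} (hg : g ∈ subdiff R x) : R x ≠ ⊤ := by
  obtain ⟨u, hu⟩ := hR.exists_ne_top
  intro h
  have := hg u
  rw [h, EReal.top_add_coe, top_le_iff] at this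
  exact hu this

theorem IsGammaZero.exists_real {n : ℕ} {R : Rn n → EReal} (hR : IsGammaZero R)
    {x : Rn n} (hx : R x ≠ ⊤) : ∃ r : ℝ, R x = (r : EReal) :=
  ⟨(R x).toReal, (EReal.coe_toReal hx (hR.ne_bot x)).symm⟩

theorem subdiff_ineq {n : ℕ} {R : Rn n → EReal} {x y g : Rn n} (hg : g ∈ subdiff R x) {r s : ℝ}
    (hx : R x = (r : EReal)) (hy : R y ≤ (s : EReal)) : r + inner ℝ g (y - x) ≤ s := by
  have := (hg y).trans hy
  rw [hx] at this
  exact_mod_cast this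

theorem mem_subdiff_of_forall_real {n : ℕ} {R : Rn n → EReal} (hR : IsGammaZero R)
    {x g : Rn n} {r : ℝ} (hx : R x = (r : EReal))
    (h : ∀ (y : Rn n) (s : ℝ), R y = (s : EReal) → r + inner ℝ g (y - x) ≤ s) :
    g ∈ subdiff R x := by
  intro y
  by_cases hy : R y = ⊤
  · rw [hy]; exact le_top
  · obtain ⟨s, hs⟩ := hR.exists_real hy
    rw [hx, hs]
    exact_mod_cast h y s hs

theorem subdiff_monotone {n : ℕ} {R : Rn n → EReal} (hR : IsGammaZero R) {x y g h : Rn n}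
    (hg : g ∈ subdiff R x) (hh : h ∈ subdiff R y) : 0 ≤ inner ℝ (g - h) (x - y) := by
  obtain ⟨r, hr⟩ := hR.exists_real (hR.ne_top_of_mem_subdiff hg)
  obtain ⟨s, hs⟩ := hR.exists_real (hR.ne_top_of_mem_subdiff hh)
  have h1 := subdiff_ineq hg hr hs.le
  have h2 := subdiff_ineq hh hs hr.le
  rw [← neg_sub x y, inner_neg_right] at h1
  rw [inner_sub_left]
  linarith

theorem nonneg_of_forall_small {A B : ℝ} (h : ∀ t : ℝ, 0 < t → t < 1 → 0 ≤ A + t * B) :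
    0 ≤ A := by
  have ht : Tendsto (fun t : ℝ => A + t * B) (𝓝[>] 0) (𝓝 (A + 0 * B)) :=
    ((continuous_const.add (continuous_id.mul continuous_const)).tendsto 0).mono_left
      nhdsWithin_le_nhds
  rw [zero_mul, add_zero] at ht
  refine ge_of_tendsto ht ?_
  filter_upwards [Ioo_mem_nhdsGT (zero_lt_one' ℝ)] with t ht
  exact h t ht.1 ht.2

/-! ### Optimality condition of the proximal map -/

/-- Fermat's rule for the proximal map: comparing `p` with `p + t (y - p)` and letting `t ↓ 0`
removes the quadratic term. -/
theorem IsProx.mem_subdiff {n : ℕ} {R : Rn n → EReal} (hR : IsGammaZero R) {γ : ℝ} (hγ : 0 < γ)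
    {z p : Rn n} (hp : IsProx R γ z p) : γ⁻¹ • (z - p) ∈ subdiff R p := by
  have hmin : ∀ u (s : ℝ), R u ≤ (s : EReal) →
      ((1 / 2 * ‖p - z‖ ^ 2 : ℝ) : EReal) + (γ : EReal) * R p ≤
        ((1 / 2 * ‖u - z‖ ^ 2 + γ * s : ℝ) : EReal) := by
    intro u s hs
    refine (hp (Set.mem_univ u)).trans ?_
    rw [EReal.coe_add, EReal.coe_mul γ s]
    exact add_le_add_right (mul_le_mul_of_nonneg_left hs (EReal.coe_nonneg.2 hγ.le)) _
  have hfin : R p ≠ ⊤ := by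
    intro htop
    obtain ⟨u, hu⟩ := hR.exists_ne_top
    obtain ⟨s, hs⟩ := hR.exists_real hu
    have := hmin u s hs.le
    rw [htop, EReal.coe_mul_top_of_pos hγ, EReal.coe_add_top, top_le_iff] at this
    exact EReal.coe_ne_top _ this
  obtain ⟨r, hr⟩ := hR.exists_real hfin
  refine mem_subdiff_of_forall_real hR hr fun y s hs => ?_
  have key : 0 ≤ (inner ℝ (p - z) (y - p) + γ * (s - r)) := by
    refine nonneg_of_forall_small (B := 1 / 2 * ‖y - p‖ ^ 2) fun t ht0 ht1 => ?_
    have h := hmin _ _ (hR.combo_le hr.le hs.le ht0.le ht1.le)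
    rw [hr] at h
    have h' : 1 / 2 * ‖p - z‖ ^ 2 + γ * r ≤
        1 / 2 * ‖p + t • (y - p) - z‖ ^ 2 + γ * (r + t * (s - r)) := by exact_mod_cast h
    have e : p + t • (y - p) - z = (p - z) + t • (y - p) := by abel
    rw [e, norm_add_sq_real, inner_smul_right, norm_smul, Real.norm_eq_abs, mul_pow, sq_abs] at h'
    have : 0 ≤ t * (inner ℝ (p - z) (y - p) + γ * (s - r) + t * (1 / 2 * ‖y - p‖ ^ 2)) := by
      nlinarith
    exact nonneg_of_mul_nonneg_right this ht0
  rw [real_inner_smul_left, ← neg_sub p z, inner_neg_left]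
  have : γ⁻¹ * (γ * (s - r)) = s - r := by field_simp
  have h2 := mul_nonneg (inv_nonneg.2 hγ.le) key
  rw [mul_add, this] at h2
  linarith

/-! ### Relative interior -/

/-- A relative interior point may be perturbed by all small vectors parallel to the set. -/
theorem exists_add_mem_of_mem_intrinsicInterior {E : Type*} [NormedAddCommGroup E]
    [NormedSpace ℝ E] {S : Set E} {g : E} (hg : g ∈ intrinsicInterior ℝ S) :
    ∃ ε > 0, ∀ d ∈ vectorSpan ℝ S, ‖d‖ < ε → g + d ∈ S := by
  obtain ⟨y, hy, rfl⟩ := mem_intrinsicInterior.1 hg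
  obtain ⟨ε, hε, hball⟩ := Metric.mem_nhds_iff.1 (mem_interior_iff_mem_nhds.1 hy)
  refine ⟨ε, hε, fun d hd hdn => ?_⟩
  have hmem : (y : E) + d ∈ affineSpan ℝ S := by
    rw [add_comm]
    exact AffineSubspace.vadd_mem_of_mem_direction (by rwa [direction_affineSpan]) y.2
  have : (⟨(y : E) + d, hmem⟩ : affineSpan ℝ S) ∈ Metric.ball y ε := by
    rw [Metric.mem_ball, Subtype.dist_eq]
    simpa [dist_eq_norm] using hdn
  exact hball this

/-! ### Tangent spaces and nearest points of embedded submanifolds -/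

theorem HasDerivAt.mem_of_eventually_mem {E : Type*} [NormedAddCommGroup E] [NormedSpace ℝ E]
    [FiniteDimensional ℝ E] (V : Submodule ℝ E) {c : ℝ → E} {w : E} {t : ℝ}
    (hc : HasDerivAt c w t) (hV : ∀ᶠ s in 𝓝 t, c s ∈ V) : w ∈ V := by
  have h := hasDerivAt_iff_tendsto_slope.1 hc
  refine V.closed_of_finiteDimensional.mem_of_tendsto h ?_
  filter_upwards [nhdsWithin_le_nhds hV] with s hs
  rw [slope_def_module]
  exact V.smul_mem _ (V.sub_mem hs hV.self_of_nhds)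

section Chart

variable {n : ℕ} {M : Set (Rn n)} {x : Rn n} {φ : OpenPartialHomeomorph (Rn n) (Rn n)}
  {V : Submodule ℝ (Rn n)}

theorem chart_symm_contDiffAt (hφs : ContDiffOn ℝ 2 φ.symm φ.target) (hx : x ∈ φ.source) :
    ContDiffAt ℝ 2 φ.symm (φ x) :=
  hφs.contDiffAt (φ.open_target.mem_nhds (φ.map_source hx))

/-- The chart inverse parametrizes `M` by `V` near `x`. -/
theorem chart_line_mem (hV : ∀ y ∈ φ.source, (y ∈ M ↔ φ y ∈ V)) (hx : x ∈ φ.source) (hxM : x ∈ M) :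
    ∀ᶠ v : V in 𝓝 0, φ.symm (φ x + v) ∈ M := by
  have hc : Continuous fun v : V => φ x + (v : Rn n) := by fun_prop
  have ht : φ.target ∈ 𝓝 (φ x + ((0 : V) : Rn n)) := by
    simpa using φ.open_target.mem_nhds (φ.map_source hx)
  filter_upwards [hc.continuousAt.preimage_mem_nhds ht] with v hv
  rw [hV _ (φ.map_target hv), φ.right_inv hv]
  exact V.add_mem ((hV x hx).1 hxM) v.2

theorem chart_hasDerivAt_line (hφs : ContDiffOn ℝ 2 φ.symm φ.target) (hx : x ∈ φ.source)
    (v : Rn n) :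
    HasDerivAt (fun t : ℝ => φ.symm (φ x + t • v)) (fderiv ℝ φ.symm (φ x) v) 0 := by
  have h1 : HasDerivAt (fun t : ℝ => φ x + t • v) v 0 := by
    simpa using ((hasDerivAt_id (0 : ℝ)).smul_const v).const_add (φ x)
  have h2 : HasFDerivAt φ.symm (fderiv ℝ φ.symm (φ x)) (φ x + (0 : ℝ) • v) := by
    simpa using ((chart_symm_contDiffAt hφs hx).differentiableAt two_ne_zero).hasFDerivAt
  exact h2.comp_hasDerivAt 0 h1

/-- The velocities of curves in `M` at `x` are exactly the images of `V` under the derivative of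
the chart inverse. -/
theorem tangentSpaceAt_eq_map (hφ : ContDiffOn ℝ 2 φ φ.source)
    (hφs : ContDiffOn ℝ 2 φ.symm φ.target) (hV : ∀ y ∈ φ.source, (y ∈ M ↔ φ y ∈ V))
    (hx : x ∈ φ.source) (hxM : x ∈ M) :
    tangentSpaceAt M x = V.map (fderiv ℝ φ.symm (φ x) : Rn n →ₗ[ℝ] Rn n) := by
  apply le_antisymm
  · refine Submodule.span_le.2 ?_
    rintro w ⟨c, hc0, hcM, hcw⟩
    subst hc0
    have hφd : HasFDerivAt φ (fderiv ℝ φ (c 0)) (c 0) :=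
      ((hφ.contDiffAt (φ.open_source.mem_nhds hx)).differentiableAt two_ne_zero).hasFDerivAt
    have hsd : HasFDerivAt φ.symm (fderiv ℝ φ.symm (φ (c 0))) (φ (c 0)) :=
      ((chart_symm_contDiffAt hφs hx).differentiableAt two_ne_zero).hasFDerivAt
    have hcs : ∀ᶠ t in 𝓝 (0 : ℝ), c t ∈ φ.source :=
      hcw.continuousAt.preimage_mem_nhds (φ.open_source.mem_nhds hx)
    have hd := hφd.comp_hasDerivAt (0 : ℝ) hcw
    refine ⟨fderiv ℝ φ (c 0) w, HasDerivAt.mem_of_eventually_mem V hd ?_, ?_⟩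
    · filter_upwards [hcM, hcs] with t h1 h2
      exact (hV _ h2).1 h1
    · have h3 := hsd.comp_hasDerivAt (0 : ℝ) hd
      have h4 : HasDerivAt c (fderiv ℝ φ.symm (φ (c 0)) (fderiv ℝ φ (c 0) w)) 0 := by
        refine h3.congr_of_eventuallyEq ?_
        filter_upwards [hcs] with t ht
        exact (φ.left_inv ht).symm
      exact h4.unique hcw
  · rintro _ ⟨v, hv, rfl⟩
    refine Submodule.subset_span ⟨fun t : ℝ => φ.symm (φ x + t • v), ?_, ?_,
      chart_hasDerivAt_line hφs hx v⟩
    · simpa using φ.left_inv hx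
    · have hc : Continuous fun t : ℝ => t • (⟨v, hv⟩ : V) := by fun_prop
      have := hc.tendsto 0
      rw [zero_smul] at this
      exact this.eventually (chart_line_mem hV hx hxM)

end Chart

theorem tangentSpaceAt_of_eventually_affine {n : ℕ} {M : Set (Rn n)} {x : Rn n}
    {A : AffineSubspace ℝ (Rn n)} (hx : x ∈ A) (hM : ∀ᶠ y in 𝓝 x, (y ∈ M ↔ y ∈ A)) :
    tangentSpaceAt M x = A.direction := by
  apply le_antisymm
  · refine Submodule.span_le.2 ?_
    rintro w ⟨c, hc0, hcM, hcw⟩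
    refine HasDerivAt.mem_of_eventually_mem A.direction (hcw.sub_const x) ?_
    have hc : Tendsto c (𝓝 0) (𝓝 x) := hc0 ▸ hcw.continuousAt
    filter_upwards [hcM, hc.eventually hM] with t h1 h2
    exact AffineSubspace.vsub_mem_direction (h2.1 h1) hx
  · intro v hv
    have hd : HasDerivAt (fun t : ℝ => x + t • v) v 0 := by
      simpa using ((hasDerivAt_id (0 : ℝ)).smul_const v).const_add x
    refine Submodule.subset_span ⟨fun t : ℝ => x + t • v, by simp, ?_, hd⟩
    have hc : Tendsto (fun t : ℝ => x + t • v) (𝓝 0) (𝓝 x) := by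
      simpa using hd.continuousAt.tendsto
    filter_upwards [hc.eventually hM] with t ht
    refine ht.2 ?_
    rw [add_comm]
    exact AffineSubspace.vadd_mem_of_mem_direction (A.direction.smul_mem t hv) hx

/-- Points near `x` have a nearest point on a compact piece of `M`; for points tending to `x` these
nearest points tend to `x` too, so in the end the boundary of the piece plays no role. -/
theorem IsC2ManifoldAround.exists_nearest {n : ℕ} {M : Set (Rn n)} {x : Rn n}
    (hM : IsC2ManifoldAround M x) {u : ℕ → Rn n} (hu : Tendsto u atTop (𝓝 x)) :
    ∃ p : ℕ → Rn n, Tendsto p atTop (𝓝 x) ∧ (∀ k, p k ∈ M) ∧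
      ∀ᶠ k in atTop, ∀ᶠ y in 𝓝[M] (p k), ‖u k - p k‖ ≤ ‖u k - y‖ := by
  obtain ⟨hxM, φ, V, hxs, hφ, hφs, hV⟩ := hM
  obtain ⟨r, hr, hball⟩ := Metric.nhds_basis_closedBall.mem_iff.1 (φ.open_source.mem_nhds hxs)
  have hcomp : IsCompact (Metric.closedBall x r ∩ M) := by
    have : Metric.closedBall x r ∩ M = Metric.closedBall x r ∩ φ ⁻¹' V := by
      ext y
      exact and_congr_right fun hy => hV y (hball hy)
    rw [this]
    refine (isCompact_closedBall x r).of_isClosed_subset ?_ Set.inter_subset_left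
    exact (φ.continuousOn.mono hball).preimage_isClosed_of_isClosed Metric.isClosed_closedBall
      V.closed_of_finiteDimensional
  have hne : (Metric.closedBall x r ∩ M).Nonempty := ⟨x, Metric.mem_closedBall_self hr.le, hxM⟩
  have hex : ∀ k, ∃ p ∈ Metric.closedBall x r ∩ M,
      ∀ y ∈ Metric.closedBall x r ∩ M, ‖u k - p‖ ≤ ‖u k - y‖ := fun k => by
    obtain ⟨p, hp, hmin⟩ := hcomp.exists_isMinOn hne
      (f := fun y => ‖u k - y‖) (by fun_prop)
    exact ⟨p, hp, fun y hy => hmin hy⟩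
  choose p hp hmin using hex
  have hlim : Tendsto p atTop (𝓝 x) := by
    have h0 : Tendsto (fun k => 2 * ‖u k - x‖) atTop (𝓝 0) := by
      simpa using (tendsto_iff_norm_sub_tendsto_zero.1 hu).const_mul 2
    refine tendsto_iff_norm_sub_tendsto_zero.2
      (squeeze_zero (fun k => norm_nonneg _) (fun k => ?_) h0)
    have h1 := hmin k x ⟨Metric.mem_closedBall_self hr.le, hxM⟩
    have h2 : p k - x = (u k - x) - (u k - p k) := by abel
    rw [h2]
    linarith [norm_sub_le (u k - x) (u k - p k)]
  refine ⟨p, hlim, fun k => (hp k).2, ?_⟩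
  filter_upwards [hlim.eventually (Metric.ball_mem_nhds x hr)] with k hk
  filter_upwards [nhdsWithin_le_nhds (Metric.isOpen_ball.mem_nhds hk), self_mem_nhdsWithin]
    with y hy hyM
  exact hmin k y ⟨Metric.ball_subset_closedBall hy, hyM⟩

/-- The residual `u - p` at a locally nearest point `p` of `M` is normal to `M`. -/
theorem inner_chart_tangent_eq_zero {n : ℕ} {M : Set (Rn n)} {p u : Rn n}
    {φ : OpenPartialHomeomorph (Rn n) (Rn n)} {V : Submodule ℝ (Rn n)}
    (hφs : ContDiffOn ℝ 2 φ.symm φ.target) (hV : ∀ y ∈ φ.source, (y ∈ M ↔ φ y ∈ V))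
    (hp : p ∈ φ.source) (hpM : p ∈ M) (hmin : ∀ᶠ y in 𝓝[M] p, ‖u - p‖ ≤ ‖u - y‖)
    {v : Rn n} (hv : v ∈ V) : inner ℝ (u - p) (fderiv ℝ φ.symm (φ p) v) = 0 := by
  set c : ℝ → Rn n := fun t => φ.symm (φ p + t • v) with hc
  have hc0 : c 0 = p := by simpa [hc] using φ.left_inv hp
  have hcd : HasDerivAt c (fderiv ℝ φ.symm (φ p) v) 0 := chart_hasDerivAt_line hφs hp v
  have hcM : ∀ᶠ t in 𝓝 (0 : ℝ), c t ∈ M := by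
    have hl : Continuous fun t : ℝ => t • (⟨v, hv⟩ : V) := by fun_prop
    have := hl.tendsto 0
    rw [zero_smul] at this
    exact this.eventually (chart_line_mem hV hp hpM)
  have hct : Tendsto c (𝓝 0) (𝓝[M] p) :=
    tendsto_nhdsWithin_iff.2 ⟨hc0 ▸ hcd.continuousAt, hcM⟩
  have hloc : IsLocalMin (fun t => ‖u - c t‖ ^ 2) 0 := by
    filter_upwards [hct.eventually hmin] with t ht
    rw [hc0]
    gcongr
  have hd := (hcd.const_sub u).norm_sq
  have h0 := hloc.hasDerivAt_eq_zero hd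
  rw [hc0, inner_neg_right] at h0
  linarith

/-! ### Identification of the active manifold -/

/-- Identification: subgradients at points tending to `x` that converge to a relative interior point
of `∂R(x)` force the points into `M`. A limit `e` of unit residuals `u k - p k` to the nearest points
of `M` is normal to `M`, hence parallel to `∂R(x)` by sharpness, so `g₀ + (ε / 2) e ∈ ∂R(x)`. Inner
semicontinuity approximates this by subgradients at `p k`, and monotonicity of `∂R` between `u k`
and `p k` gives `-(ε / 2) ≥ 0` in the limit. -/
theorem IsPartlySmoothAt.eventually_mem {n : ℕ} {R : Rn n → EReal} (hR : IsGammaZero R)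
    {M : Set (Rn n)} {x : Rn n} (hM : IsPartlySmoothAt R M x) {u g : ℕ → Rn n} {g₀ : Rn n}
    (hu : Tendsto u atTop (𝓝 x)) (hg : Tendsto g atTop (𝓝 g₀)) (hsub : ∀ k, g k ∈ subdiff R (u k))
    (hri : g₀ ∈ intrinsicInterior ℝ (subdiff R x)) : ∀ᶠ k in atTop, u k ∈ M := by
  by_contra hcon
  obtain ⟨σ, hσ, huσ⟩ := extraction_of_frequently_atTop (not_eventually.1 hcon)
  obtain ⟨p, hpx, hpM, hmin⟩ := hM.manifold.exists_nearest (hu.comp hσ.tendsto_atTop)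
  obtain ⟨hxM, φ, V, hxs, hφ, hφs, hV⟩ := hM.manifold
  have hne : ∀ k, ‖u (σ k) - p k‖ ≠ 0 := fun k h =>
    huσ k (by rw [sub_eq_zero.1 (norm_eq_zero.1 h)]; exact hpM k)
  set d : ℕ → Rn n := fun k => ‖u (σ k) - p k‖⁻¹ • (u (σ k) - p k) with hd
  have hdn : ∀ k, d k ∈ Metric.sphere (0 : Rn n) 1 := fun k => by
    rw [mem_sphere_zero_iff_norm, hd, norm_smul, norm_inv, norm_norm, inv_mul_cancel₀ (hne k)]
  obtain ⟨e, he, τ, hτ, hdτ⟩ := (isCompact_sphere (0 : Rn n) 1).tendsto_subseq hdn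
  rw [mem_sphere_zero_iff_norm] at he
  have hpτ : Tendsto (p ∘ τ) atTop (𝓝 x) := hpx.comp hτ.tendsto_atTop
  have hminτ := hτ.tendsto_atTop.eventually hmin
  -- `Dφ.symm` is continuous, so normality at `p k` passes to the limit
  have hnormal : ∀ v ∈ V, inner ℝ e (fderiv ℝ φ.symm (φ x) v) = 0 := by
    intro v hv
    have hcont : ContinuousAt (fun y => fderiv ℝ φ.symm (φ y) v) x := by
      have h1 : ContinuousAt (fderiv ℝ φ.symm) (φ x) :=
        ((chart_symm_contDiffAt hφs hxs).fderiv_right (m := 1) (by norm_num)).continuousAt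
      exact (h1.comp (φ.continuousAt hxs)).clm_apply continuousAt_const
    have hl : Tendsto (fun k => inner ℝ (d (τ k)) (fderiv ℝ φ.symm (φ (p (τ k))) v)) atTop
        (𝓝 (inner ℝ e (fderiv ℝ φ.symm (φ x) v))) := hdτ.inner (hcont.tendsto.comp hpτ)
    refine tendsto_nhds_unique hl (tendsto_const_nhds.congr' ?_)
    filter_upwards [hpτ.eventually (φ.open_source.mem_nhds hxs), hminτ] with k hk hmk
    have h0 : inner ℝ (u (σ (τ k)) - p (τ k)) (fderiv ℝ φ.symm (φ (p (τ k))) v) = 0 :=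
      inner_chart_tangent_eq_zero hφs hV hk (hpM _) hmk hv
    simp only [hd]
    rw [real_inner_smul_left, h0, mul_zero]
  have hpar : e ∈ vectorSpan ℝ (subdiff R x) := by
    rw [← Submodule.orthogonal_orthogonal (vectorSpan ℝ (subdiff R x))]
    change e ∈ (modelSubspace R x)ᗮ
    rw [← hM.sharp, tangentSpaceAt_eq_map hφ hφs hV hxs hxM, Submodule.mem_orthogonal']
    rintro _ ⟨v, hv, rfl⟩
    exact hnormal v hv
  obtain ⟨ε, hε, hball⟩ := exists_add_mem_of_mem_intrinsicInterior hri
  have hmem : g₀ + (ε / 2) • e ∈ subdiff R x := by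
    refine hball _ (Submodule.smul_mem _ _ hpar) ?_
    rw [norm_smul, he, Real.norm_eq_abs, abs_of_pos (half_pos hε)]
    linarith
  have hpτM : Tendsto (p ∘ τ) atTop (𝓝[M] x) :=
    tendsto_nhdsWithin_iff.2 ⟨hpτ, Eventually.of_forall fun k => hpM _⟩
  have hgl : Tendsto (fun k => g (σ (τ k))) atTop (𝓝 g₀) :=
    hg.comp (hσ.tendsto_atTop.comp hτ.tendsto_atTop)
  -- the inner product below tends to `-(ε / 2)`, which outweighs the error `ε / 4` made in
  -- approximating `g₀ + (ε / 2) e` by a subgradient at `p k`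
  have h1 : ∀ᶠ k in atTop, inner ℝ (g (σ (τ k)) - g₀ - (ε / 2) • e) (d (τ k)) < -(ε / 4) := by
    have hl : Tendsto (fun k => inner ℝ (g (σ (τ k)) - g₀ - (ε / 2) • e) (d (τ k))) atTop
        (𝓝 (inner ℝ (g₀ - g₀ - (ε / 2) • e) e)) :=
      ((hgl.sub_const g₀).sub_const _).inner hdτ
    refine hl.eventually (gt_mem_nhds ?_)
    rw [sub_self, zero_sub, inner_neg_left, real_inner_smul_left, real_inner_self_eq_norm_sq, he]
    linarith
  have h2 := hpτM.eventually
    (hM.continuous.inner _ hmem _ (Metric.ball_mem_nhds _ (show 0 < ε / 4 by positivity)))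
  obtain ⟨k, hk1, h, hh, hhb⟩ := (h1.and h2).exists
  have hmon := subdiff_monotone hR (hsub (σ (τ k))) hh
  have hmon' : 0 ≤ inner ℝ (g (σ (τ k)) - h) (d (τ k)) := by
    rw [hd, real_inner_smul_right]
    exact mul_nonneg (by positivity) hmon
  rw [Metric.mem_ball, dist_eq_norm] at hhb
  have hcs := real_inner_le_norm (g₀ + (ε / 2) • e - h) (d (τ k))
  rw [mem_sphere_zero_iff_norm.1 (hdn _), mul_one, norm_sub_rev] at hcs
  have hsplit : g (σ (τ k)) - h =
      (g (σ (τ k)) - g₀ - (ε / 2) • e) + (g₀ + (ε / 2) • e - h) := by abel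
  rw [hsplit, inner_add_left] at hmon'
  linarith

/-! ### Manifolds contained in their affine tangent space -/

/-- A `C²` manifold that lies in its affine tangent space near `x` fills it near `x`: in a chart the
inclusion is a map `V → T` with surjective derivative, so it is open at `0`. -/
theorem eventually_mem_of_subset_affine {n : ℕ} {M : Set (Rn n)} {x : Rn n}
    (hM : IsC2ManifoldAround M x) (hsub : ∀ᶠ y in 𝓝[M] x, y - x ∈ tangentSpaceAt M x) :
    ∀ᶠ y in 𝓝 x, (y ∈ M ↔ y ∈ AffineSubspace.mk' x (tangentSpaceAt M x)) := by
  obtain ⟨hxM, φ, V, hxs, hφ, hφs, hV⟩ := hM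
  have htan := tangentSpaceAt_eq_map hφ hφs hV hxs hxM
  set T := tangentSpaceAt M x with hT
  set E := fderiv ℝ φ.symm (φ x) with hE
  -- the chart inverse, read in the coordinates `V → T`
  set ψ : V → T := fun v => T.orthogonalProjectionOnto (φ.symm (φ x + v) - x) with hψ
  have hψ0 : ψ 0 = 0 := by simp [hψ, φ.left_inv hxs]
  have hstrict : HasStrictFDerivAt ψ (T.orthogonalProjectionOnto ∘L E ∘L V.subtypeL) 0 := by
    have h1 : HasStrictFDerivAt (fun v : V => φ x + (v : Rn n)) V.subtypeL 0 :=
      V.subtypeL.hasStrictFDerivAt.const_add (φ x)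
    have h2 : HasStrictFDerivAt φ.symm E (φ x + ((0 : V) : Rn n)) := by
      simpa using (chart_symm_contDiffAt hφs hxs).hasStrictFDerivAt two_ne_zero
    have h3 : HasStrictFDerivAt (fun v : V => φ.symm (φ x + v)) (E ∘L V.subtypeL) 0 :=
      HasStrictFDerivAt.comp (g := φ.symm) (f := fun v : V => φ x + (v : Rn n)) 0 h2 h1
    exact T.orthogonalProjectionOnto.hasStrictFDerivAt.comp 0 (h3.sub_const x)
  have hsurj : (T.orthogonalProjectionOnto ∘L E ∘L V.subtypeL).range = ⊤ := by
    refine LinearMap.range_eq_top.2 fun w => ?_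
    have hw : (w : Rn n) ∈ V.map (E : Rn n →ₗ[ℝ] Rn n) := htan ▸ w.2
    obtain ⟨v, hv, hvw⟩ := hw
    refine ⟨⟨v, hv⟩, ?_⟩
    have hvw' : E v = w := hvw
    simp [hvw']
  have hmap := hstrict.map_nhds_eq_of_surj hsurj
  rw [hψ0] at hmap
  have hcont : Tendsto (fun v : V => φ.symm (φ x + v)) (𝓝 0) (𝓝 x) := by
    have h1 : Tendsto (fun v : V => φ x + (v : Rn n)) (𝓝 0) (𝓝 (φ x)) := by
      have : Continuous fun v : V => φ x + (v : Rn n) := by fun_prop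
      simpa using this.tendsto 0
    have h2 := (φ.symm.continuousAt (φ.map_source hxs)).tendsto
    rw [φ.left_inv hxs] at h2
    exact h2.comp h1
  have hmem := chart_line_mem hV hxs hxM
  have hin : ∀ᶠ v : V in 𝓝 0, x + (ψ v : Rn n) ∈ M := by
    have := (tendsto_nhdsWithin_iff.2 ⟨hcont, hmem⟩).eventually hsub
    filter_upwards [hmem, this] with v hv1 hv2
    have : (ψ v : Rn n) = φ.symm (φ x + v) - x :=
      congrArg Subtype.val (T.orthogonalProjectionOnto_mem_subspace_eq_self ⟨_, hv2⟩)
    rwa [this, add_sub_cancel]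
  have hT0 : ∀ᶠ w : T in 𝓝 0, x + (w : Rn n) ∈ M := by
    rw [← hmap]
    exact eventually_map.2 hin
  have hpr : Tendsto (fun y => T.orthogonalProjectionOnto (y - x)) (𝓝 x) (𝓝 0) := by
    have : Continuous fun y => T.orthogonalProjectionOnto (y - x) := by fun_prop
    simpa using this.tendsto x
  filter_upwards [eventually_nhdsWithin_iff.1 hsub, hpr.eventually hT0] with y hy1 hy2
  rw [AffineSubspace.mem_mk', vsub_eq_sub]
  refine ⟨hy1, fun hy => ?_⟩
  have : (T.orthogonalProjectionOnto (y - x) : Rn n) = y - x :=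
    congrArg Subtype.val (T.orthogonalProjectionOnto_mem_subspace_eq_self ⟨_, hy⟩)
  rwa [this, add_sub_cancel] at hy2

/-! ### Locally polyhedral functions -/

theorem IsLocallyPolyhedralAt.exists_halfSpaces {n : ℕ} {R : Rn n → EReal} {x : Rn n}
    (h : IsLocallyPolyhedralAt R x) : ∃ s : Finset (Rn n × ℝ × ℝ), ∀ᶠ y in 𝓝 x, ∀ r : ℝ,
      R y ≤ (r : EReal) ↔ ∀ q ∈ s, inner ℝ q.1 y + q.2.1 * r ≤ q.2.2 := by
  obtain ⟨P, ⟨s, hs⟩, hP⟩ := h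
  refine ⟨s, ?_⟩
  filter_upwards [hP] with y hy r
  rw [hy]
  exact hs y r

/-- A half-space constraint that holds on `epi R` near `x` and is active at `(x, R x)` does not
increase towards any point of `epi R`, near or far. -/
theorem active_direction_nonpos {n : ℕ} {R : Rn n → EReal} (hR : IsGammaZero R) {x y q : Rn n}
    {r s α β : ℝ} (hx : R x = (r : EReal)) (hy : R y = (s : EReal))
    (hq : ∀ᶠ z in 𝓝 x, ∀ r : ℝ, R z ≤ (r : EReal) → inner ℝ q z + α * r ≤ β)
    (hact : inner ℝ q x + α * r = β) : inner ℝ q (y - x) + α * (s - r) ≤ 0 := by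
  have hc : Tendsto (fun t : ℝ => x + t • (y - x)) (𝓝[>] 0) (𝓝 x) := by
    have : Continuous fun t : ℝ => x + t • (y - x) := by fun_prop
    simpa using (this.tendsto 0).mono_left nhdsWithin_le_nhds
  obtain ⟨t, ht, ht0, ht1⟩ :=
    ((hc.eventually hq).and (Ioo_mem_nhdsGT (zero_lt_one' ℝ))).exists
  have h := ht _ (hR.combo_le hx.le hy.le ht0.le ht1.le)
  rw [inner_add_right, real_inner_smul_right] at h
  by_contra! hpos
  have := mul_pos ht0 hpos
  linarith

/-- For a locally polyhedral `R`, subgradients at points of `M` near `x` are subgradients at `x`: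
no constraint becomes active when passing from `x` to a nearby point, so every feasible direction at
`(x, R x)` remains feasible at `(u, R u)`. Continuity of `R` along `M` comes from the
extension `f`. -/
theorem IsLocallyPolyhedralAt.eventually_subdiff_subset {n : ℕ} {R : Rn n → EReal}
    (hR : IsGammaZero R) {x : Rn n} (h : IsLocallyPolyhedralAt R x) {f : Rn n → ℝ} {M : Set (Rn n)}
    (hxM : x ∈ M) (hf : ContinuousAt f x) (hRf : ∀ᶠ y in 𝓝[M] x, R y = (f y : EReal)) :
    ∀ᶠ u in 𝓝[M] x, subdiff R u ⊆ subdiff R x := by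
  obtain ⟨s, hs⟩ := h.exists_halfSpaces
  have hfx : R x = (f x : EReal) := hRf.self_of_nhdsWithin hxM
  have hstrict : ∀ᶠ u in 𝓝 x, ∀ q ∈ s, inner ℝ q.1 x + q.2.1 * f x < q.2.2 →
      inner ℝ q.1 u + q.2.1 * f u < q.2.2 := by
    refine (eventually_all_finset s).2 fun q _ => ?_
    by_cases hq : inner ℝ q.1 x + q.2.1 * f x < q.2.2
    · have hc : ContinuousAt (fun u => inner ℝ q.1 u + q.2.1 * f u) x := by fun_prop
      filter_upwards [hc.eventually (gt_mem_nhds hq)] with u hu _ using hu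
    · exact Eventually.of_forall fun u hu => absurd hu hq
  filter_upwards [hRf, nhdsWithin_le_nhds hstrict, nhdsWithin_le_nhds hs.eventually_nhds]
    with u hfu hu hsu g hg
  refine mem_subdiff_of_forall_real hR hfx fun y v hv => ?_
  have hsx := hs.self_of_nhds (f x)
  -- moving from `(u, R u)` in the direction `(y, R y) - (x, R x)` stays in the epigraph
  have hmove : ∀ᶠ t in 𝓝[>] (0 : ℝ),
      R (u + t • (y - x)) ≤ ((f u + t * (v - f x) : ℝ) : EReal) := by
    have hc : Tendsto (fun t : ℝ => u + t • (y - x)) (𝓝[>] 0) (𝓝 u) := by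
      have : Continuous fun t : ℝ => u + t • (y - x) := by fun_prop
      simpa using (this.tendsto 0).mono_left nhdsWithin_le_nhds
    have hineq : ∀ᶠ t in 𝓝[>] (0 : ℝ), ∀ q ∈ s,
        inner ℝ q.1 (u + t • (y - x)) + q.2.1 * (f u + t * (v - f x)) ≤ q.2.2 := by
      refine (eventually_all_finset s).2 fun q hq => ?_
      by_cases hqx : inner ℝ q.1 x + q.2.1 * f x < q.2.2
      · have hcq : Continuous fun t : ℝ =>
            inner ℝ q.1 (u + t • (y - x)) + q.2.1 * (f u + t * (v - f x)) := by fun_prop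
        have h0 := hcq.tendsto 0
        simp only [zero_smul, add_zero, zero_mul] at h0
        filter_upwards [nhdsWithin_le_nhds (h0.eventually (gt_mem_nhds (hu q hq hqx)))]
          with t ht using ht.le
      · have hact : inner ℝ q.1 x + q.2.1 * f x = q.2.2 :=
          le_antisymm (hsx.1 hfx.le q hq) (not_lt.1 hqx)
        have hdir := active_direction_nonpos hR hfx hv
          (hs.mono fun z hz r hr => (hz r).1 hr q hq) hact
        have hbase := (hsu.self_of_nhds (f u)).1 hfu.le q hq
        filter_upwards [self_mem_nhdsWithin] with t ht
        rw [inner_add_right, real_inner_smul_right]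
        nlinarith [mul_nonneg (le_of_lt (Set.mem_Ioi.1 ht)) (neg_nonneg.2 hdir)]
    filter_upwards [hc.eventually hsu, hineq] with t h1 h2 using (h1 _).2 h2
  obtain ⟨t, ht, ht0⟩ := (hmove.and self_mem_nhdsWithin).exists
  have hk := subdiff_ineq hg hfu ht
  rw [add_sub_cancel_left, real_inner_smul_right] at hk
  have : t * inner ℝ g (y - x) ≤ t * (v - f x) := by linarith
  have := le_of_mul_le_mul_left this ht0
  linarith

/-- For a locally polyhedral `R`, near `x` the manifold lies in `x + T_x` and `R` is affine on it.
Some `g ∈ ∂R(u) ⊆ ∂R(x)` is close to `g₀`, hence relatively interior, and it maximizes `⟨·, u - x⟩`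
over `∂R(x)`; therefore `u - x` is orthogonal to `par (∂R(x))`. -/
theorem IsPartlySmoothAt.eventually_affine_of_polyhedral {n : ℕ} {R : Rn n → EReal}
    (hR : IsGammaZero R) {M : Set (Rn n)} {x : Rn n} (hM : IsPartlySmoothAt R M x)
    (h : IsLocallyPolyhedralAt R x) {g₀ : Rn n} (hg₀ : g₀ ∈ intrinsicInterior ℝ (subdiff R x)) :
    ∃ r : ℝ, ∀ᶠ u in 𝓝[M] x,
      u - x ∈ modelSubspace R x ∧ R u = ((r + inner ℝ g₀ (u - x) : ℝ) : EReal) := by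
  obtain ⟨f, hf, hRf⟩ := hM.smooth
  have hxM := hM.manifold.1
  have hfx : R x = (f x : EReal) := hRf.self_of_nhdsWithin hxM
  obtain ⟨ε, hε, hball⟩ := exists_add_mem_of_mem_intrinsicInterior hg₀
  have hg₀S := intrinsicInterior_subset hg₀
  refine ⟨f x, ?_⟩
  filter_upwards [hRf, h.eventually_subdiff_subset hR hxM hf.continuousAt hRf,
    hM.continuous.inner g₀ hg₀S _ (Metric.ball_mem_nhds g₀ hε)] with u hfu hsub hne
  obtain ⟨g, hgu, hgb⟩ := hne
  have hgx := hsub hgu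
  rw [Metric.mem_ball, dist_eq_norm] at hgb
  have hup : f u - f x ≤ inner ℝ g (u - x) := by
    have := subdiff_ineq hgu hfu hfx.le
    rw [← neg_sub u x, inner_neg_right] at this
    linarith
  have hlow : ∀ g' ∈ subdiff R x, inner ℝ g' (u - x) ≤ f u - f x := fun g' hg' => by
    linarith [subdiff_ineq hg' hfx hfu.le]
  have hdiff : g - g₀ ∈ vectorSpan ℝ (subdiff R x) := vsub_mem_vectorSpan ℝ hgx hg₀S
  -- `g` is itself relatively interior, so it may be perturbed within the parallel subspace
  have hnonpos : ∀ w ∈ vectorSpan ℝ (subdiff R x), inner ℝ w (u - x) ≤ 0 := by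
    intro w hw
    have hc : Tendsto (fun t : ℝ => ‖g - g₀ + t • w‖) (𝓝[>] 0) (𝓝 ‖g - g₀‖) := by
      have : Continuous fun t : ℝ => ‖g - g₀ + t • w‖ := by fun_prop
      simpa using (this.tendsto 0).mono_left nhdsWithin_le_nhds
    obtain ⟨t, ht, ht0⟩ := ((hc.eventually (gt_mem_nhds hgb)).and self_mem_nhdsWithin).exists
    have hmem := hball _ (Submodule.add_mem _ hdiff (Submodule.smul_mem _ t hw)) ht
    have hle := hlow _ hmem
    rw [← add_assoc, add_sub_cancel, inner_add_left, real_inner_smul_left] at hle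
    have : t * inner ℝ w (u - x) ≤ t * 0 := by linarith
    exact le_of_mul_le_mul_left this ht0
  have hzero : ∀ w ∈ vectorSpan ℝ (subdiff R x), inner ℝ w (u - x) = 0 := fun w hw =>
    le_antisymm (hnonpos w hw) (by simpa using hnonpos (-w) (Submodule.neg_mem _ hw))
  refine ⟨(Submodule.mem_orthogonal _ _).2 hzero, ?_⟩
  have h0 := hzero _ hdiff
  rw [inner_sub_left] at h0
  rw [hfu]
  congr 1
  linarith [hlow g hgx]

/-! ### Riemannian derivatives of affine functions -/

theorem hasRiemannianGradAt_of_affine {n : ℕ} {M : Set (Rn n)} {R : Rn n → EReal}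
    {T : Submodule ℝ (Rn n)} {x y g₀ : Rn n} {r : ℝ} (hy : y ∈ M)
    (h : ∀ᶠ z in 𝓝 y, (z ∈ M ↔ z ∈ AffineSubspace.mk' x T) ∧
      (z ∈ M → R z = ((r + inner ℝ g₀ (z - x) : ℝ) : EReal))) :
    HasRiemannianGradAt M R y (T.starProjection g₀) := by
  have hyA := h.self_of_nhds.1.1 hy
  have htan : tangentSpaceAt M y = T := by
    rw [tangentSpaceAt_of_eventually_affine hyA (h.mono fun z hz => hz.1),
      AffineSubspace.direction_mk']
  refine ⟨hy, fun z => r + inner ℝ g₀ (z - x), ⟨contDiffAt_const.add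
    (contDiffAt_const.inner ℝ (contDiffAt_id.sub contDiffAt_const)), ?_⟩, ?_⟩
  · exact eventually_nhdsWithin_iff.2 (h.mono fun z hz => hz.2)
  · have hgrad : HasGradientAt (fun z => r + inner ℝ g₀ (z - x)) g₀ y := by
      rw [hasGradientAt_iff_hasFDerivAt]
      have h1 : HasFDerivAt (fun z : Rn n => inner ℝ g₀ z) (innerSL ℝ g₀) y :=
        (innerSL ℝ g₀).hasFDerivAt
      have h2 := (h1.sub_const (inner ℝ g₀ x)).const_add r
      simp only [inner_sub_right]
      exact h2
    rw [hgrad.gradient]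
    simp only [htan]

theorem hasRiemannianHessAt_zero_of_affine {n : ℕ} {M : Set (Rn n)} {R : Rn n → EReal}
    {T : Submodule ℝ (Rn n)} {x y g₀ : Rn n} {r : ℝ} (hy : y ∈ M)
    (h : ∀ᶠ z in 𝓝 y, (z ∈ M ↔ z ∈ AffineSubspace.mk' x T) ∧
      (z ∈ M → R z = ((r + inner ℝ g₀ (z - x) : ℝ) : EReal))) :
    HasRiemannianHessAt M R y 0 := by
  refine ⟨hy, fun _ => T.starProjection g₀, 0, ?_, hasFDerivWithinAt_const _ _ _, fun w => by simp⟩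
  filter_upwards [nhdsWithin_le_nhds h.eventually_nhds, self_mem_nhdsWithin] with z hz hzM
  exact hasRiemannianGradAt_of_affine hzM hz

/-! ### The inertial forward–backward iteration -/

theorem tendsto_inertialPoint {n : ℕ} {x : ℕ → Rn n} {xs : Rn n} (hx : Tendsto x atTop (𝓝 xs))
    {a : ℕ → ℝ} (h0 : ∀ k, 0 ≤ a k) (h1 : ∀ k, a k ≤ 1) :
    Tendsto (inertialPoint x a) atTop (𝓝 xs) := by
  have hpred : Tendsto (fun k => x (k - 1)) atTop (𝓝 xs) := hx.comp (tendsto_sub_atTop_nat 1)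
  have hd : Tendsto (fun k => ‖x k - x (k - 1)‖) atTop (𝓝 0) := by
    simpa using (hx.sub hpred).norm
  have hs : Tendsto (fun k => a k • (x k - x (k - 1))) atTop (𝓝 0) := by
    refine squeeze_zero_norm (fun k => ?_) hd
    rw [norm_smul, Real.norm_eq_abs, abs_of_nonneg (h0 k)]
    exact mul_le_of_le_one_left (norm_nonneg _) (h1 k)
  have hsum := hx.add hs
  rwa [add_zero] at hsum

theorem inertialPoint_mem_affineSubspace {n : ℕ} {A : AffineSubspace ℝ (Rn n)} {x : ℕ → Rn n}
    {a : ℕ → ℝ} {k : ℕ} (h1 : x k ∈ A) (h2 : x (k - 1) ∈ A) : inertialPoint x a k ∈ A := by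
  have := AffineSubspace.vadd_mem_of_mem_direction
    (A.direction.smul_mem (a k) (AffineSubspace.vsub_mem_direction h1 h2)) h1
  rwa [vadd_eq_add, add_comm] at this

/-- The forward–backward iterates are identified by their proximal subgradients
`γ_k⁻¹ (y_{a,k} - x_{k+1}) - ∇F(y_{b,k})`, which tend to `-∇F(x⋆)` because `γ_k` stays away from
`0`. -/
theorem IsFBSequence.eventually_mem {n : ℕ} {F : Rn n → ℝ} {R : Rn n → EReal}
    {β abar bbar ε₁ ε₂ : ℝ} {a b γ : ℕ → ℝ} {x : ℕ → Rn n} (hR : IsGammaZero R)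
    (hF : Continuous (gradient F)) (hx : IsFBSequence F R β abar bbar ε₁ ε₂ a b γ x) {xs : Rn n}
    (hlim : Tendsto x atTop (𝓝 xs)) {M : Set (Rn n)} (hM : IsPartlySmoothAt R M xs)
    (hND : -gradient F xs ∈ intrinsicInterior ℝ (subdiff R xs)) : ∀ᶠ k in atTop, x k ∈ M := by
  have hγ : ∀ k, 0 < γ k := fun k => hx.eps₁_pos.trans_le (hx.step_mem k).1
  have ha := tendsto_inertialPoint hlim (fun k => (hx.a_mem k).1)
    fun k => (hx.a_mem k).2.trans hx.abar_le
  have hb := tendsto_inertialPoint hlim (fun k => (hx.b_mem k).1)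
    fun k => (hx.b_mem k).2.trans hx.bbar_le
  have hsucc : Tendsto (fun k => x (k + 1)) atTop (𝓝 xs) := (tendsto_add_atTop_iff_nat 1).2 hlim
  have hquot : Tendsto (fun k => (γ k)⁻¹ • (inertialPoint x a k - x (k + 1))) atTop (𝓝 0) := by
    have hd : Tendsto (fun k => ε₁⁻¹ * ‖inertialPoint x a k - x (k + 1)‖) atTop (𝓝 0) := by
      simpa using (ha.sub hsucc).norm.const_mul ε₁⁻¹
    refine squeeze_zero_norm (fun k => ?_) hd
    rw [norm_smul, norm_inv, Real.norm_eq_abs, abs_of_pos (hγ k)]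
    have := hx.eps₁_pos
    have := (hx.step_mem k).1
    gcongr
  have hg : Tendsto (fun k => (γ k)⁻¹ • (inertialPoint x a k -
      γ k • gradient F (inertialPoint x b k) - x (k + 1))) atTop (𝓝 (-gradient F xs)) := by
    have := hquot.sub ((hF.tendsto xs).comp hb)
    rw [zero_sub] at this
    refine this.congr fun k => ?_
    rw [Function.comp_apply, sub_right_comm, smul_sub _ (_ - _), inv_smul_smul₀ (hγ k).ne']
  have hev := hM.eventually_mem hR hsucc hg (fun k => (hx.iter k).mem_subdiff hR (hγ k)) hND
  obtain ⟨N, hN⟩ := eventually_atTop.1 hev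
  refine eventually_atTop.2 ⟨N + 1, fun k hk => ?_⟩
  have := hN (k - 1) (by omega)
  rwa [Nat.sub_add_cancel (by omega)] at this

theorem theorem3p4 {n : ℕ} (F : Rn n → ℝ) (R : Rn n → EReal) (β : ℝ)
    (hR : IsGammaZero R)
    (hβ : 0 < β) (hF : ContDiff ℝ 1 F)
    (hFlip : ∀ u v, ‖gradient F u - gradient F v‖ ≤ 1 / β * ‖u - v‖)
    (abar bbar ε₁ ε₂ : ℝ) (a b γ : ℕ → ℝ) (x : ℕ → Rn n)
    (hx : IsFBSequence F R β abar bbar ε₁ ε₂ a b γ x)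
    (xs : Rn n) (hlim : Tendsto x atTop (𝓝 xs))
    (hmin : IsMinOn (fun u => (F u : EReal) + R u) Set.univ xs)
    (M : Set (Rn n)) (hM : IsPartlySmoothAt R M xs)
    (hF2 : ContDiffAt ℝ 2 F xs)
    (hND : -gradient F xs ∈ intrinsicInterior ℝ (subdiff R xs)) :
    ∃ K : ℕ, 0 < K ∧ (∀ k ≥ K, x k ∈ M) ∧
      ((∃ A : AffineSubspace ℝ (Rn n), M = (A : Set (Rn n))) →
        M = (AffineSubspace.mk' xs (modelSubspace R xs) : Set (Rn n)) ∧
        ∀ k > K, inertialPoint x a k ∈ M ∧ inertialPoint x b k ∈ M) ∧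
      (IsLocallyPolyhedralAt R xs →
        (∃ U ∈ 𝓝 xs,
          M ∩ U = (AffineSubspace.mk' xs (modelSubspace R xs) : Set (Rn n)) ∩ U) ∧
        (∀ k > K,
          (inertialPoint x a k ∈ M ∧
            inertialPoint x a k ∈ AffineSubspace.mk' xs (modelSubspace R xs)) ∧
          (inertialPoint x b k ∈ M ∧
            inertialPoint x b k ∈ AffineSubspace.mk' xs (modelSubspace R xs))) ∧
        ∃ g : Rn n, HasRiemannianGradAt M R xs g ∧
          ∀ k ≥ K, HasRiemannianGradAt M R (x k) g ∧ HasRiemannianHessAt M R (x k) 0) := by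
  have hgradF : Continuous (gradient F) :=
    (LipschitzWith.of_dist_le' fun u v => by
      rw [dist_eq_norm, dist_eq_norm]; exact hFlip u v).continuous
  have hxsM := hM.manifold.1
  have hpoly : IsLocallyPolyhedralAt R xs → ∃ r : ℝ, ∀ᶠ y in 𝓝 xs,
      (y ∈ M ↔ y ∈ AffineSubspace.mk' xs (modelSubspace R xs)) ∧
        (y ∈ M → R y = ((r + inner ℝ (-gradient F xs) (y - xs) : ℝ) : EReal)) := fun h => by
    obtain ⟨r, hr⟩ := hM.eventually_affine_of_polyhedral hR h hND
    have hA := eventually_mem_of_subset_affine hM.manifold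
      (hr.mono fun y hy => hM.sharp ▸ hy.1)
    rw [hM.sharp] at hA
    refine ⟨r, ?_⟩
    filter_upwards [hA, eventually_nhdsWithin_iff.1 hr] with y h1 h2
      using ⟨h1, fun hy => (h2 hy).2⟩
  have ha := tendsto_inertialPoint hlim (fun k => (hx.a_mem k).1)
    fun k => (hx.a_mem k).2.trans hx.abar_le
  have hb := tendsto_inertialPoint hlim (fun k => (hx.b_mem k).1)
    fun k => (hx.b_mem k).2.trans hx.bbar_le
  -- `N` is the threshold after which everything relevant lies in a neighbourhood of `xs`
  obtain ⟨N, hNM, hN⟩ : ∃ N : ℕ, (∀ k ≥ N, x k ∈ M) ∧ (IsLocallyPolyhedralAt R xs →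
      ∃ r : ℝ, ∃ W : Set (Rn n), IsOpen W ∧ xs ∈ W ∧ (∀ y ∈ W,
        (y ∈ M ↔ y ∈ AffineSubspace.mk' xs (modelSubspace R xs)) ∧
        (y ∈ M → R y = ((r + inner ℝ (-gradient F xs) (y - xs) : ℝ) : EReal))) ∧
        ∀ k ≥ N, x k ∈ W ∧ inertialPoint x a k ∈ W ∧ inertialPoint x b k ∈ W) := by
    have hid := hx.eventually_mem hR hgradF hlim hM hND
    by_cases hloc : IsLocallyPolyhedralAt R xs
    · obtain ⟨r, hr⟩ := hpoly hloc
      obtain ⟨W, hW, hWo, hxW⟩ := eventually_nhds_iff.1 hr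
      have hWn := hWo.mem_nhds hxW
      obtain ⟨N, hN⟩ := eventually_atTop.1 (hid.and ((hlim.eventually hWn).and
        ((ha.eventually hWn).and (hb.eventually hWn))))
      exact ⟨N, fun k hk => (hN k hk).1, fun _ => ⟨r, W, hWo, hxW, hW, fun k hk => (hN k hk).2⟩⟩
    · obtain ⟨N, hN⟩ := eventually_atTop.1 hid
      exact ⟨N, hN, fun h => absurd h hloc⟩
  refine ⟨N + 1, N.succ_pos, fun k hk => hNM k (by omega), ?_, ?_⟩
  · rintro ⟨A, rfl⟩
    have hdir : A.direction = modelSubspace R xs := by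
      rw [← hM.sharp,
        tangentSpaceAt_of_eventually_affine hxsM (Eventually.of_forall fun _ => Iff.rfl)]
    refine ⟨by rw [← hdir, AffineSubspace.mk'_eq hxsM], fun k hk => ?_⟩
    have h1 := hNM k (by omega)
    have h2 := hNM (k - 1) (by omega)
    exact ⟨inertialPoint_mem_affineSubspace h1 h2, inertialPoint_mem_affineSubspace h1 h2⟩
  · intro hloc
    obtain ⟨r, W, hWo, hxW, hW, hWN⟩ := hN hloc
    have hnear : ∀ y ∈ W, ∀ᶠ z in 𝓝 y,
        (z ∈ M ↔ z ∈ AffineSubspace.mk' xs (modelSubspace R xs)) ∧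
        (z ∈ M → R z = ((r + inner ℝ (-gradient F xs) (z - xs) : ℝ) : EReal)) := fun y hy =>
      Eventually.mono (hWo.mem_nhds hy) hW
    refine ⟨⟨W, hWo.mem_nhds hxW, ?_⟩, fun k hk => ?_, _,
      hasRiemannianGradAt_of_affine hxsM (hnear xs hxW), fun k hk => ?_⟩
    · ext y
      exact and_congr_left fun hy => (hW y hy).1
    · have hA : ∀ j ≥ N, x j ∈ AffineSubspace.mk' xs (modelSubspace R xs) := fun j hj =>
        (hW _ (hWN j hj).1).1.1 (hNM j hj)
      have h1 := hA k (by omega)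
      have h2 := hA (k - 1) (by omega)
      obtain ⟨-, hak, hbk⟩ := hWN k (by omega)
      have hya := inertialPoint_mem_affineSubspace (a := a) h1 h2
      have hyb := inertialPoint_mem_affineSubspace (a := b) h1 h2
      exact ⟨⟨(hW _ hak).1.2 hya, hya⟩, (hW _ hbk).1.2 hyb, hyb⟩
    · have hkM := hNM k (by omega)
      have hkW := hnear _ (hWN k (by omega)).1
      exact ⟨hasRiemannianGradAt_of_affine hkM hkW, hasRiemannianHessAt_zero_of_affine hkM hkW⟩
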